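/- Let $n\ge 2$, let $A_n$ be an alphabet with $n$ letters and $A_n^*$ the free monoid on it. A right ideal of $A_n^*$ is finitely generated if it has the form $XA_n^*$ with $X\subseteq A_n^*$ finite (possibly empty). Let $D_n$ be the inverse monoid, under composition of partial functions, of all bijections $\theta\colon R_1\to R_2$ between finitely generated right ideals of $A_n^*$ such that $\theta(rs)=\theta(r)s$ for all $r\in R_1$, $s\in A_n^*$; its zero is the empty function. In an inverse monoid write $a\le b$ if $a=ba^{-1}a$ (the natural partial order). The Lenz congruence $\equiv$ on an inverse monoid with zero is defined by: $s\equiv t$ if and only if for each $0\neq x\le s$ there is $z\neq 0$ with $z\le x$ and $z\le t$, and for each $0\ne y\le t$ there is $z\neq 0$ with $z\le y$ and $z\le s$. Put $C_n=D_n/{\equiv}$, the Cuntz inverse monoid. Call a non-zero idempotent $e$ essential if $ef\ne 0$ for every non-zero idempotent $f$; let $D_n^e$ be the inverse submonoid of those $a\in D_n$ for which $a^{-1}a$ and $aa^{-1}$ are both essential, let $\sigma$ be the congruence on $D_n^e$ given by $a\mathrel{\sigma}b$ if and only if there is $c\in D_n^e$ with $c\le a$ and $c\le b$, and let $G_{n,1}=D_n^e/\sigma$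 (the Thompson group). Then $C_n$ is a Boolean inverse $\wedge$-monoid, that is: $C_n$ is an inverse monoid with zero; any two elements $a,b$ that are compatible (meaning that $a^{-1}b$ and $ab^{-1}$ are idempotents) have a join $a\vee b$ for the natural partial order, and multiplication on the left and on the right distributes over such joins; the idempotents of $C_n$ form a Boolean algebra under the natural partial order; and any two elements of $C_n$ have a meet for the natural partial order. Moreover the group of units of $C_n$ is isomorphic to $G_{n,1}$. -/

import Mathlib

/-- An inverse monoid: every element `a` has a unique inverse `a⁻¹`, that is, a unique element
with `a * a⁻¹ * a = a` and `a⁻¹ * a * a⁻¹ = a⁻¹`. -/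
class InverseMonoid (M : Type*) extends Monoid M, Inv M where
  mul_inv_mul : ∀ a : M, a * a⁻¹ * a = a
  inv_mul_inv : ∀ a : M, a⁻¹ * a * a⁻¹ = a⁻¹
  eq_inv : ∀ a b : M, a * b * a = a → b * a * b = b → b = a⁻¹

/-- An inverse monoid with zero. -/
class InverseMonoidWithZero (M : Type*) extends InverseMonoid M, MonoidWithZero M

namespace InverseMonoid

section Basic

variable {M : Type*} [InverseMonoid M]

/-- The domain idempotent `d(a) = a⁻¹ a`. -/
def dom (a : M) : M := a⁻¹ * a

/-- The range idempotent `r(a) = a a⁻¹`. -/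
def ran (a : M) : M := a * a⁻¹

/-- The natural partial order: `a ≤ b` if and only if `a = b a⁻¹ a`. -/
def NatLE (a b : M) : Prop := a = b * (a⁻¹ * a)

/-- The compatibility relation: `a⁻¹ b` and `a b⁻¹` are both idempotents. -/
def Compatible (a b : M) : Prop := IsIdempotentElem (a⁻¹ * b) ∧ IsIdempotentElem (a * b⁻¹)

/-- `c` is the join of `a` and `b` for the natural partial order. -/
def IsJoin (a b c : M) : Prop :=
  NatLE a c ∧ NatLE b c ∧ ∀ d : M, NatLE a d → NatLE b d → NatLE c d

/-- `c` is the meet of `a` and `b` for the natural partial order. -/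
def IsMeet (a b c : M) : Prop :=
  NatLE c a ∧ NatLE c b ∧ ∀ d : M, NatLE d a → NatLE d b → NatLE d c

theorem idem_mul_idem {e f : M} (he : e * e = e) (hf : f * f = f) : (e * f) * (e * f) = e * f := by
  have h1 : (e * f) * (f * (e * f)⁻¹ * e) * (e * f) = e * f := by
    calc (e * f) * (f * (e * f)⁻¹ * e) * (e * f)
        = e * (f * f) * (e * f)⁻¹ * (e * e) * f := by simp only [mul_assoc]
      _ = (e * f) * (e * f)⁻¹ * (e * f) := by rw [he, hf]; simp only [mul_assoc]
      _ = e * f := mul_inv_mul _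
  have h2 : (f * (e * f)⁻¹ * e) * (e * f) * (f * (e * f)⁻¹ * e) = f * (e * f)⁻¹ * e := by
    calc (f * (e * f)⁻¹ * e) * (e * f) * (f * (e * f)⁻¹ * e)
        = f * (e * f)⁻¹ * (e * e) * (f * f) * (e * f)⁻¹ * e := by simp only [mul_assoc]
      _ = f * ((e * f)⁻¹ * (e * f) * (e * f)⁻¹) * e := by rw [he, hf]; simp only [mul_assoc]
      _ = f * (e * f)⁻¹ * e := by rw [inv_mul_inv]
  have h3 := eq_inv _ _ h1 h2
  have h4 : (e * f)⁻¹ * (e * f)⁻¹ = (e * f)⁻¹ := by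
    calc (e * f)⁻¹ * (e * f)⁻¹
        = (f * (e * f)⁻¹ * e) * (f * (e * f)⁻¹ * e) := by rw [h3]
      _ = f * ((e * f)⁻¹ * (e * f) * (e * f)⁻¹) * e := by simp only [mul_assoc]
      _ = (e * f)⁻¹ := by rw [inv_mul_inv, h3]
  have h5 : e * f = ((e * f)⁻¹)⁻¹ := eq_inv _ _ (inv_mul_inv _) (mul_inv_mul _)
  have h6 : (e * f)⁻¹ = ((e * f)⁻¹)⁻¹ := eq_inv _ _ (by rw [h4, h4]) (by rw [h4, h4])
  rw [h5, ← h6, h4]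

theorem idem_comm {e f : M} (he : e * e = e) (hf : f * f = f) : e * f = f * e := by
  have h1 := idem_mul_idem he hf
  have h2 := idem_mul_idem hf he
  have h3 : f * e = (e * f)⁻¹ := by
    apply eq_inv
    · calc (e * f) * (f * e) * (e * f) = e * (f * f) * (e * e) * f := by simp only [mul_assoc]
        _ = (e * f) * (e * f) := by rw [he, hf]; simp only [mul_assoc]
        _ = e * f := h1
    · calc (f * e) * (e * f) * (f * e) = f * (e * e) * (f * f) * e := by simp only [mul_assoc]
        _ = (f * e) * (f * e) := by rw [he, hf]; simp only [mul_assoc]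
        _ = f * e := h2
  have h4 : e * f = (e * f)⁻¹ := eq_inv _ _ (by rw [h1, h1]) (by rw [h1, h1])
  rw [h3, ← h4]

theorem inv_eq_of_regular {a b c : M} (h1 : a * b * a = a) (h2 : b * a * b = b)
    (h3 : a * c * a = a) (h4 : c * a * c = c) : b = c :=
  (eq_inv a b h1 h2).trans (eq_inv a c h3 h4).symm

theorem inv_inv' (a : M) : (a⁻¹)⁻¹ = a :=
  (eq_inv _ _ (inv_mul_inv a) (mul_inv_mul a)).symm

theorem dom_idem (a : M) : (a⁻¹ * a) * (a⁻¹ * a) = a⁻¹ * a := by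
  rw [← mul_assoc, inv_mul_inv]

theorem ran_idem (a : M) : (a * a⁻¹) * (a * a⁻¹) = a * a⁻¹ := by
  rw [← mul_assoc, mul_inv_mul]

theorem inv_of_idem {e : M} (he : e * e = e) : e⁻¹ = e :=
  (eq_inv _ _ (by rw [he, he]) (by rw [he, he])).symm

theorem mul_inv_rev' (a b : M) : (a * b)⁻¹ = b⁻¹ * a⁻¹ := by
  symm
  have hc := idem_comm (ran_idem b) (dom_idem a)
  apply eq_inv
  · calc a * b * (b⁻¹ * a⁻¹) * (a * b) = a * ((b * b⁻¹) * (a⁻¹ * a)) * b := by simp only [mul_assoc]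
      _ = (a * a⁻¹ * a) * (b * b⁻¹ * b) := by rw [hc]; simp only [mul_assoc]
      _ = a * b := by rw [mul_inv_mul, mul_inv_mul]
  · calc b⁻¹ * a⁻¹ * (a * b) * (b⁻¹ * a⁻¹) = b⁻¹ * ((a⁻¹ * a) * (b * b⁻¹)) * a⁻¹ := by
          simp only [mul_assoc]
      _ = (b⁻¹ * b * b⁻¹) * (a⁻¹ * a * a⁻¹) := by rw [← hc]; simp only [mul_assoc]
      _ = b⁻¹ * a⁻¹ := by rw [inv_mul_inv, inv_mul_inv]

/-- Conjugates of idempotents are idempotents. -/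
theorem conj_idem (a : M) {e : M} (he : e * e = e) : (a * e * a⁻¹) * (a * e * a⁻¹) = a * e * a⁻¹ := by
  calc (a * e * a⁻¹) * (a * e * a⁻¹) = a * (e * (a⁻¹ * a)) * e * a⁻¹ := by simp only [mul_assoc]
    _ = (a * a⁻¹ * a) * (e * e) * a⁻¹ := by rw [idem_comm he (dom_idem a)]; simp only [mul_assoc]
    _ = a * e * a⁻¹ := by rw [mul_inv_mul, he]

theorem conj_idem' (a : M) {e : M} (he : e * e = e) : (a⁻¹ * e * a) * (a⁻¹ * e * a) = a⁻¹ * e * a := by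
  have := conj_idem a⁻¹ he
  rwa [inv_inv'] at this

/-- Moving an idempotent past an element, from right to left. -/
theorem mul_idem_eq (a : M) {e : M} (he : e * e = e) : a * e = (a * e * a⁻¹) * a := by
  calc a * e = a * a⁻¹ * a * e := by rw [mul_inv_mul]
    _ = a * ((a⁻¹ * a) * e) := by simp only [mul_assoc]
    _ = (a * e * a⁻¹) * a := by rw [idem_comm (dom_idem a) he]; simp only [mul_assoc]

/-- Moving an idempotent past an element, from left to right. -/
theorem idem_mul_eq (a : M) {e : M} (he : e * e = e) : e * a = a * (a⁻¹ * e * a) := by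
  calc e * a = e * (a * a⁻¹ * a) := by rw [mul_inv_mul]
    _ = (e * (a * a⁻¹)) * a := by simp only [mul_assoc]
    _ = a * (a⁻¹ * e * a) := by rw [idem_comm he (ran_idem a)]; simp only [mul_assoc]

theorem natLE_of_eq_mul_idem {a b e : M} (he : e * e = e) (h : a = b * e) : NatLE a b := by
  have h1 : a * e = a := by rw [h, mul_assoc, he]
  have h2 : b * (a⁻¹ * a) = b * e * (a⁻¹ * a) := by
    conv_lhs => rw [← h1]
    rw [mul_inv_rev', inv_of_idem he]
    calc b * (e * a⁻¹ * (a * e)) = b * (e * ((a⁻¹ * a) * e)) := by simp only [mul_assoc]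
      _ = b * ((e * e) * (a⁻¹ * a)) := by rw [idem_comm (dom_idem a) he]; simp only [mul_assoc]
      _ = _ := by rw [he]; simp only [mul_assoc]
  unfold NatLE
  rw [h2, ← h, ← mul_assoc, mul_inv_mul]

theorem natLE_of_eq_idem_mul {a b e : M} (he : e * e = e) (h : a = e * b) : NatLE a b :=
  natLE_of_eq_mul_idem (conj_idem' b he) (h.trans (idem_mul_eq b he))

theorem natLE_refl (a : M) : NatLE a a :=
  natLE_of_eq_mul_idem (mul_one 1) (mul_one a).symm

theorem natLE_trans {a b c : M} (h1 : NatLE a b) (h2 : NatLE b c) : NatLE a c := by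
  refine natLE_of_eq_mul_idem (idem_mul_idem (dom_idem b) (dom_idem a)) ?_
  have h1' : a = b * (a⁻¹ * a) := h1
  have h2' : b = c * (b⁻¹ * b) := h2
  rw [← mul_assoc, ← h2', ← h1']

theorem natLE_mul_left (s : M) {a b : M} (h : NatLE a b) : NatLE (s * a) (s * b) := by
  refine natLE_of_eq_mul_idem (dom_idem a) ?_
  have h' : a = b * (a⁻¹ * a) := h
  rw [mul_assoc, ← h']

theorem natLE_mul_right (s : M) {a b : M} (h : NatLE a b) : NatLE (a * s) (b * s) := by
  have h' : a = (b * (a⁻¹ * a) * b⁻¹) * b := by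
    rw [← mul_idem_eq b (dom_idem a)]; exact h
  refine natLE_of_eq_idem_mul (conj_idem b (dom_idem a)) ?_
  rw [← mul_assoc, ← h']

theorem natLE_mul {a b c d : M} (h1 : NatLE a b) (h2 : NatLE c d) : NatLE (a * c) (b * d) :=
  natLE_trans (natLE_mul_left a h2) (natLE_mul_right d h1)

end Basic

/-- A monoid in which every element has some inverse and idempotents commute is inverse. -/
theorem regular_inverse_unique {M : Type*} [Monoid M]
    (hc : ∀ e f : M, e * e = e → f * f = f → e * f = f * e) {a b c : M}
    (h1 : a * b * a = a) (h2 : b * a * b = b) (h3 : a * c * a = a) (h4 : c * a * c = c) :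
    b = c := by
  have hba : (b * a) * (b * a) = b * a := by rw [← mul_assoc, h2]
  have hca : (c * a) * (c * a) = c * a := by rw [← mul_assoc, h4]
  have hab : (a * b) * (a * b) = a * b := by rw [← mul_assoc, h1]
  have hac : (a * c) * (a * c) = a * c := by rw [← mul_assoc, h3]
  calc b = b * (a * c * a) * b := by rw [h3, h2]
    _ = (b * a) * (c * a) * b := by simp only [mul_assoc]
    _ = (c * a) * (b * a) * b := by rw [hc _ _ hba hca]
    _ = c * (a * b * a) * b := by simp only [mul_assoc]
    _ = c * (a * c * a) * b := by rw [h1, h3]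
    _ = c * ((a * c) * (a * b)) := by simp only [mul_assoc]
    _ = c * ((a * b) * (a * c)) := by rw [hc _ _ hac hab]
    _ = c * (a * b * a) * c := by simp only [mul_assoc]
    _ = c := by rw [h1, h4]

theorem quotient_idem_comm {M : Type*} [InverseMonoid M] (c : Con M) (e f : c.Quotient)
    (he : e * e = e) (hf : f * f = f) : e * f = f * e := by
  have hidem : ∀ q : c.Quotient, q * q = q → ∃ e : M, e * e = e ∧ (e : c.Quotient) = q := by
    intro q hq
    induction q using Con.induction_on with
    | H x =>
      refine ⟨x * (x * x)⁻¹ * x, ?_, ?_⟩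
      · calc x * (x * x)⁻¹ * x * (x * (x * x)⁻¹ * x)
            = x * ((x * x)⁻¹ * (x * x) * (x * x)⁻¹) * x := by simp only [mul_assoc]
          _ = _ := by rw [inv_mul_inv]
      · have h1 : ((x * x * (x * x)⁻¹ * (x * x) : M) : c.Quotient) = ((x * x : M) : c.Quotient) := by
          rw [mul_inv_mul]
        simp only [Con.coe_mul] at h1 hq ⊢
        rwa [hq] at h1
  obtain ⟨e, he', rfl⟩ := hidem e he
  obtain ⟨f, hf', rfl⟩ := hidem f hf
  rw [← Con.coe_mul, ← Con.coe_mul, idem_comm he' hf']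

/-- Congruences on an inverse monoid respect inverses. -/
theorem con_inv {M : Type*} [InverseMonoid M] (c : Con M) {a b : M} (h : c a b) : c a⁻¹ b⁻¹ := by
  have hab : (a : c.Quotient) = (b : c.Quotient) := (Con.eq c).2 h
  refine (Con.eq c).1 (regular_inverse_unique (quotient_idem_comm c) (a := (a : c.Quotient))
    ?_ ?_ ?_ ?_)
  · rw [← Con.coe_mul, ← Con.coe_mul, mul_inv_mul]
  · rw [← Con.coe_mul, ← Con.coe_mul, inv_mul_inv]
  · rw [hab, ← Con.coe_mul, ← Con.coe_mul, mul_inv_mul]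
  · rw [hab, ← Con.coe_mul, ← Con.coe_mul, inv_mul_inv]

/-- The inverse of a class modulo a congruence is the class of the inverse. -/
def quotientInv {M : Type*} [InverseMonoid M] (c : Con M) : c.Quotient → c.Quotient :=
  Quotient.map (fun a : M => a⁻¹) (fun _ _ h => con_inv c h)

/-- The minimum group congruence `σ`: `a σ b` if and only if there is `c ≤ a, b`. -/
def sigma (M : Type*) [InverseMonoid M] : Con M where
  r a b := ∃ c : M, NatLE c a ∧ NatLE c b
  iseqv := {
    refl := fun a => ⟨a, natLE_refl a, natLE_refl a⟩
    symm := fun ⟨c, h1, h2⟩ => ⟨c, h2, h1⟩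
    trans := by
      rintro a b d ⟨x, hxa, hxb⟩ ⟨y, hyb, hyd⟩
      have hxb' : x = b * (x⁻¹ * x) := hxb
      have hyb' : y = b * (y⁻¹ * y) := hyb
      refine ⟨b * ((x⁻¹ * x) * (y⁻¹ * y)), ?_, ?_⟩
      · rw [← mul_assoc, ← hxb']
        exact natLE_trans (natLE_of_eq_mul_idem (dom_idem y) rfl) hxa
      · rw [idem_comm (dom_idem x) (dom_idem y), ← mul_assoc, ← hyb']
        exact natLE_trans (natLE_of_eq_mul_idem (dom_idem x) rfl) hyd }
  mul' := by
    rintro a b c d ⟨x, hxa, hxb⟩ ⟨y, hyc, hyd⟩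
    exact ⟨x * y, natLE_mul hxa hyc, natLE_mul hxb hyd⟩

/-- An inverse monoid with zero is distributive if compatible pairs have joins and
multiplication distributes over such joins. -/
structure IsDistributive (M : Type*) [InverseMonoidWithZero M] : Prop where
  exists_join : ∀ a b : M, Compatible a b → ∃ c : M, IsJoin a b c
  mul_join : ∀ s a b c : M, Compatible a b → IsJoin a b c → IsJoin (s * a) (s * b) (s * c)
  join_mul : ∀ s a b c : M, Compatible a b → IsJoin a b c → IsJoin (a * s) (b * s) (c * s)

/-- A Boolean inverse monoid: a distributive inverse monoid whose idempotents form a Boolean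
algebra under the natural partial order. -/
structure IsBoolean (M : Type*) [InverseMonoidWithZero M] : Prop where
  distributive : IsDistributive M
  boolean : ∃ B : BooleanAlgebra {e : M // IsIdempotentElem e},
    ∀ e f : {e : M // IsIdempotentElem e}, B.le e f ↔ NatLE (e : M) (f : M)

/-- A Boolean inverse `∧`-monoid: a Boolean inverse monoid in which any two elements have a meet. -/
structure IsBooleanMeet (M : Type*) [InverseMonoidWithZero M] : Prop where
  isBoolean : IsBoolean M
  exists_meet : ∀ a b : M, ∃ c : M, IsMeet a b c

section Zero

variable {M : Type*} [InverseMonoidWithZero M]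

/-- The Lenz relation: below each non-zero `x ≤ s` there is a non-zero element that is also
below `t`, and conversely. -/
def Lenz (s t : M) : Prop :=
  (∀ x : M, x ≠ 0 → NatLE x s → ∃ z : M, z ≠ 0 ∧ NatLE z x ∧ NatLE z t) ∧
  (∀ y : M, y ≠ 0 → NatLE y t → ∃ z : M, z ≠ 0 ∧ NatLE z y ∧ NatLE z s)

theorem lenz_half_mul_right {s t : M} (p : M)
    (h : ∀ x : M, x ≠ 0 → NatLE x s → ∃ z : M, z ≠ 0 ∧ NatLE z x ∧ NatLE z t) (x : M)
    (hx0 : x ≠ 0) (hx : NatLE x (s * p)) : ∃ z : M, z ≠ 0 ∧ NatLE z x ∧ NatLE z (t * p) := by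
  have hx' : x = s * p * (x⁻¹ * x) := hx
  have hy : NatLE (x * p⁻¹) s := by
    refine natLE_of_eq_mul_idem (conj_idem p (dom_idem x)) ?_
    conv_lhs => rw [hx']
    simp only [mul_assoc]
  have hyp : x * p⁻¹ * p = x := by
    calc x * p⁻¹ * p = s * p * (x⁻¹ * x) * p⁻¹ * p := by rw [← hx']
      _ = s * p * ((x⁻¹ * x) * (p⁻¹ * p)) := by simp only [mul_assoc]
      _ = s * (p * p⁻¹ * p) * (x⁻¹ * x) := by
        rw [idem_comm (dom_idem x) (dom_idem p)]; simp only [mul_assoc]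
      _ = x := by rw [mul_inv_mul, ← hx']
  have hy0 : x * p⁻¹ ≠ 0 := by
    intro h0
    rw [h0, zero_mul] at hyp
    exact hx0 hyp.symm
  obtain ⟨z, hz0, hzy, hzt⟩ := h _ hy0 hy
  refine ⟨z * p, ?_, ?_, natLE_mul_right p hzt⟩
  · intro h0
    apply hz0
    have hz' : z = x * p⁻¹ * (z⁻¹ * z) := hzy
    calc z = x * (p⁻¹ * p * p⁻¹) * (z⁻¹ * z) := by rw [inv_mul_inv, ← hz']
      _ = x * p⁻¹ * ((p * p⁻¹) * (z⁻¹ * z)) := by simp only [mul_assoc]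
      _ = (x * p⁻¹ * (z⁻¹ * z)) * p * p⁻¹ := by
        rw [idem_comm (ran_idem p) (dom_idem z)]; simp only [mul_assoc]
      _ = 0 := by rw [← hz', h0, zero_mul]
  · have := natLE_mul_right p hzy
    rwa [hyp] at this

theorem lenz_half_mul_left {s t : M} (p : M)
    (h : ∀ x : M, x ≠ 0 → NatLE x s → ∃ z : M, z ≠ 0 ∧ NatLE z x ∧ NatLE z t) (x : M)
    (hx0 : x ≠ 0) (hx : NatLE x (p * s)) : ∃ z : M, z ≠ 0 ∧ NatLE z x ∧ NatLE z (p * t) := by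
  have hx' : x = p * s * (x⁻¹ * x) := hx
  have hy : NatLE (p⁻¹ * x) s := by
    have h1 : NatLE (p⁻¹ * x) (p⁻¹ * (p * s)) := natLE_mul_left _ hx
    refine natLE_trans h1 (natLE_of_eq_idem_mul (dom_idem p) ?_)
    rw [mul_assoc]
  have hyp : p * (p⁻¹ * x) = x := by
    calc p * (p⁻¹ * x) = p * (p⁻¹ * (p * s * (x⁻¹ * x))) := by rw [← hx']
      _ = p * p⁻¹ * p * s * (x⁻¹ * x) := by simp only [mul_assoc]
      _ = x := by rw [mul_inv_mul, ← hx']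
  have hy0 : p⁻¹ * x ≠ 0 := by
    intro h0
    rw [h0, mul_zero] at hyp
    exact hx0 hyp.symm
  obtain ⟨z, hz0, hzy, hzt⟩ := h _ hy0 hy
  refine ⟨p * z, ?_, ?_, natLE_mul_left p hzt⟩
  · intro h0
    apply hz0
    have hz' : z = p⁻¹ * x * (z⁻¹ * z) := hzy
    calc z = (p⁻¹ * p * p⁻¹) * x * (z⁻¹ * z) := by rw [inv_mul_inv, ← hz']
      _ = p⁻¹ * (p * (p⁻¹ * x * (z⁻¹ * z))) := by simp only [mul_assoc]
      _ = 0 := by rw [← hz', h0, mul_zero]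
  · have := natLE_mul_left p hzy
    rwa [hyp] at this

theorem lenz_trans {s t u : M} (h1 : Lenz s t) (h2 : Lenz t u) : Lenz s u := by
  constructor
  · intro x hx0 hx
    obtain ⟨z, hz0, hzx, hzt⟩ := h1.1 x hx0 hx
    obtain ⟨w, hw0, hwz, hwu⟩ := h2.1 z hz0 hzt
    exact ⟨w, hw0, natLE_trans hwz hzx, hwu⟩
  · intro x hx0 hx
    obtain ⟨z, hz0, hzx, hzt⟩ := h2.2 x hx0 hx
    obtain ⟨w, hw0, hwz, hwu⟩ := h1.2 z hz0 hzt
    exact ⟨w, hw0, natLE_trans hwz hzx, hwu⟩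

variable (M) in
/-- The Lenz congruence `≡`. -/
def lenzCon : Con M where
  r := Lenz
  iseqv := {
    refl := fun s => ⟨fun x h0 h => ⟨x, h0, natLE_refl x, h⟩, fun x h0 h => ⟨x, h0, natLE_refl x, h⟩⟩
    symm := fun h => ⟨h.2, h.1⟩
    trans := lenz_trans }
  mul' := by
    intro s t p q h1 h2
    exact lenz_trans (t := t * p)
      ⟨lenz_half_mul_right p h1.1, lenz_half_mul_right p h1.2⟩
      ⟨lenz_half_mul_left t h2.1, lenz_half_mul_left t h2.2⟩

/-- A non-zero idempotent is essential if its product with every non-zero idempotent is non-zero. -/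
def IsEssentialIdem (e : M) : Prop :=
  IsIdempotentElem e ∧ e ≠ 0 ∧ ∀ f : M, IsIdempotentElem f → f ≠ 0 → e * f ≠ 0

/-- An element is essential if its domain and range idempotents are both essential. -/
def IsEssential (a : M) : Prop := IsEssentialIdem (dom a) ∧ IsEssentialIdem (ran a)

theorem essential_dom_mul {a b : M} (ha : IsEssentialIdem (dom a)) (hb : IsEssentialIdem (dom b)) :
    IsEssentialIdem (dom (a * b)) := by
  have hd : dom (a * b) = b⁻¹ * (a⁻¹ * a) * b := by
    unfold dom; rw [mul_inv_rev']; simp only [mul_assoc]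
  have key : ∀ f : M, IsIdempotentElem f → f ≠ 0 → dom (a * b) * f ≠ 0 := by
    intro f hf hf0 h0
    have hg0 : dom b * f ≠ 0 := hb.2.2 f hf hf0
    have hg : (dom b * f) * (dom b * f) = dom b * f := idem_mul_idem (dom_idem b) hf
    have hbf : b * f ≠ 0 := by
      intro h; apply hg0; unfold dom; rw [mul_assoc, h, mul_zero]
    have hk0 : b * f * b⁻¹ ≠ 0 := by
      intro h; apply hbf; rw [mul_idem_eq b hf, h, zero_mul]
    apply ha.2.2 _ (conj_idem b hf) hk0
    unfold dom
    rw [hd] at h0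
    calc a⁻¹ * a * (b * f * b⁻¹) = a⁻¹ * a * ((b * b⁻¹ * b) * f * b⁻¹) := by rw [mul_inv_mul]
      _ = ((a⁻¹ * a) * (b * b⁻¹)) * b * f * b⁻¹ := by simp only [mul_assoc]
      _ = b * (b⁻¹ * (a⁻¹ * a) * b * f) * b⁻¹ := by
        rw [idem_comm (dom_idem a) (ran_idem b)]; simp only [mul_assoc]
      _ = 0 := by rw [h0, mul_zero, zero_mul]
  refine ⟨dom_idem _, ?_, key⟩
  intro h0
  apply key (dom b) hb.1 hb.2.1
  rw [h0, zero_mul]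

theorem dom_inv (a : M) : dom a⁻¹ = ran a := by unfold dom ran; rw [inv_inv']

theorem ran_inv (a : M) : ran a⁻¹ = dom a := by unfold dom ran; rw [inv_inv']

theorem isEssential_mul {a b : M} (ha : IsEssential a) (hb : IsEssential b) :
    IsEssential (a * b) := by
  refine ⟨essential_dom_mul ha.1 hb.1, ?_⟩
  rw [← dom_inv, mul_inv_rev']
  exact essential_dom_mul (by rw [dom_inv]; exact hb.2) (by rw [dom_inv]; exact ha.2)

theorem isEssential_inv {a : M} (ha : IsEssential a) : IsEssential a⁻¹ :=
  ⟨by rw [dom_inv]; exact ha.2, by rw [ran_inv]; exact ha.1⟩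

theorem isEssential_one [Nontrivial M] : IsEssential (1 : M) := by
  have h1 : (1 : M)⁻¹ = 1 := inv_of_idem (mul_one 1)
  have h : IsEssentialIdem (1 : M) :=
    ⟨mul_one 1, one_ne_zero, fun f _ hf => by rwa [one_mul]⟩
  unfold IsEssential dom ran
  rw [h1, mul_one]
  exact ⟨h, h⟩

variable (M) in
/-- The inverse submonoid `Mᵉ` of essential elements. -/
def essential [Nontrivial M] : Submonoid M where
  carrier := {a | IsEssential a}
  mul_mem' := isEssential_mul
  one_mem' := isEssential_one

instance essentialInverseMonoid [Nontrivial M] : InverseMonoid (essential M) where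
  inv a := ⟨(a : M)⁻¹, isEssential_inv a.2⟩
  mul_inv_mul a := Subtype.ext (mul_inv_mul (a : M))
  inv_mul_inv a := Subtype.ext (inv_mul_inv (a : M))
  eq_inv a b h1 h2 := Subtype.ext
    (eq_inv (a : M) (b : M) (congrArg Subtype.val h1) (congrArg Subtype.val h2))

/-- The quotient of an inverse monoid with zero by a congruence is an inverse monoid with zero. -/
@[reducible] def quotientInverseMonoidWithZero (c : Con M) : InverseMonoidWithZero c.Quotient where
  inv := quotientInv c
  zero := ((0 : M) : c.Quotient)
  zero_mul q := by
    induction q using Con.induction_on with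
    | H x => exact congrArg _ (zero_mul x)
  mul_zero q := by
    induction q using Con.induction_on with
    | H x => exact congrArg _ (mul_zero x)
  mul_inv_mul q := by
    induction q using Con.induction_on with
    | H x => exact congrArg (fun y : M => (y : c.Quotient)) (mul_inv_mul x)
  inv_mul_inv q := by
    induction q using Con.induction_on with
    | H x => exact congrArg (fun y : M => (y : c.Quotient)) (inv_mul_inv x)
  eq_inv q r h1 h2 := by
    induction q using Con.induction_on with
    | H x =>
      exact regular_inverse_unique (quotient_idem_comm c) h1 h2
        (congrArg (fun y : M => (y : c.Quotient)) (mul_inv_mul x))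
        (congrArg (fun y : M => (y : c.Quotient)) (inv_mul_inv x))

end Zero

end InverseMonoid

namespace Cuntz

/-- The free monoid on an alphabet with `n` letters. -/
abbrev Words (n : ℕ) : Type := FreeMonoid (Fin n)

/-- A finitely generated right ideal `X Aₙ*` with `X` finite (possibly empty). -/
def IsFGRightIdeal {n : ℕ} (R : Set (Words n)) : Prop :=
  ∃ X : Finset (Words n), R = {w | ∃ x ∈ X, ∃ u : Words n, w = x * u}

/-- The domain of definition of a partial bijection. -/
def source {n : ℕ} (f : Words n ≃. Words n) : Set (Words n) := {w | ∃ v, v ∈ f w}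

/-- The image of a partial bijection. -/
def target {n : ℕ} (f : Words n ≃. Words n) : Set (Words n) := {v | ∃ w, v ∈ f w}

end Cuntz

open Cuntz in
/-- The elements of `Dₙ`: bijective morphisms between finitely generated right ideals of the free
monoid on `n` letters, regarded as partial bijections of the free monoid. -/
@[ext] structure DMonoid (n : ℕ) where
  toPEquiv : Words n ≃. Words n
  source_fg : IsFGRightIdeal (source toPEquiv)
  target_fg : IsFGRightIdeal (target toPEquiv)
  map_mul : ∀ r v s : Words n, v ∈ toPEquiv r → v * s ∈ toPEquiv (r * s)

namespace DMonoid

open Cuntz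

variable {n : ℕ}

theorem prefix_comparable {x y u v : Words n} (h : x * u = y * v) :
    (∃ p, x = y * p) ∨ (∃ p, y = x * p) := by
  have h' : x.toList ++ u.toList = y.toList ++ v.toList := congrArg FreeMonoid.toList h
  rcases List.append_eq_append_iff.1 h' with ⟨p, hp, _⟩ | ⟨p, hp, _⟩
  · exact Or.inr ⟨FreeMonoid.ofList p, hp⟩
  · exact Or.inl ⟨FreeMonoid.ofList p, hp⟩

theorem fg_inter {R S : Set (Words n)} (hR : IsFGRightIdeal R) (hS : IsFGRightIdeal S) :
    IsFGRightIdeal (R ∩ S) := by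
  classical
  obtain ⟨X, rfl⟩ := hR
  obtain ⟨Y, rfl⟩ := hS
  refine ⟨X.filter (fun x => ∃ y ∈ Y, ∃ p, x = y * p) ∪
    Y.filter (fun y => ∃ x ∈ X, ∃ p, y = x * p), ?_⟩
  ext w
  simp only [Set.mem_inter_iff, Set.mem_ofPred_eq, Finset.mem_union, Finset.mem_filter]
  constructor
  · rintro ⟨⟨x, hx, u, rfl⟩, ⟨y, hy, v, h⟩⟩
    rcases prefix_comparable h with ⟨p, hp⟩ | ⟨p, hp⟩
    · exact ⟨x, Or.inl ⟨hx, y, hy, p, hp⟩, u, rfl⟩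
    · exact ⟨y, Or.inr ⟨hy, x, hx, p, hp⟩, v, h⟩
  · rintro ⟨z, ⟨hz, y, hy, p, rfl⟩ | ⟨hz, x, hx, p, rfl⟩, u, rfl⟩
    · exact ⟨⟨_, hz, u, rfl⟩, ⟨y, hy, p * u, mul_assoc _ _ _⟩⟩
    · exact ⟨⟨x, hx, p * u, mul_assoc _ _ _⟩, ⟨_, hz, u, rfl⟩⟩

theorem fg_mul_mem {R : Set (Words n)} (hR : IsFGRightIdeal R) {w : Words n} (hw : w ∈ R)
    (u : Words n) : w * u ∈ R := by
  obtain ⟨X, rfl⟩ := hR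
  obtain ⟨x, hx, v, rfl⟩ := hw
  exact ⟨x, hx, v * u, mul_assoc _ _ _⟩

theorem symm_map_mul (f : DMonoid n) (r v s : Words n) (h : v ∈ f.toPEquiv.symm r) :
    v * s ∈ f.toPEquiv.symm (r * s) := by
  rw [PEquiv.mem_iff_mem] at h ⊢
  exact f.map_mul _ _ _ h

theorem source_symm (f : Words n ≃. Words n) : source f.symm = target f := by
  ext w; simp only [source, target, Set.mem_ofPred_eq, PEquiv.mem_iff_mem]

theorem target_symm (f : Words n ≃. Words n) : target f.symm = source f := by
  ext w; simp only [source, target, Set.mem_ofPred_eq, PEquiv.mem_iff_mem]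

/-- The inverse partial bijection. -/
instance : Inv (DMonoid n) where
  inv f :=
    { toPEquiv := f.toPEquiv.symm
      source_fg := by rw [source_symm]; exact f.target_fg
      target_fg := by rw [target_symm]; exact f.source_fg
      map_mul := f.symm_map_mul }

/-- The image of a finitely generated right ideal under a bijective morphism. -/
theorem fg_image (f : DMonoid n) {S : Set (Words n)} (hS : IsFGRightIdeal S) :
    IsFGRightIdeal {v | ∃ w ∈ S, v ∈ f.toPEquiv w} := by
  classical
  obtain ⟨X, hX⟩ := fg_inter f.source_fg hS
  have hmem : ∀ x ∈ X, x ∈ source f.toPEquiv ∩ S := by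
    intro x hx; rw [hX]; exact ⟨x, hx, 1, (mul_one x).symm⟩
  refine ⟨X.image (fun x => (f.toPEquiv x).getD 1), ?_⟩
  ext v
  simp only [Set.mem_ofPred_eq, Finset.mem_image]
  constructor
  · rintro ⟨w, hw, hv⟩
    have : w ∈ source f.toPEquiv ∩ S := ⟨⟨v, hv⟩, hw⟩
    rw [hX] at this
    obtain ⟨x, hx, u, rfl⟩ := this
    obtain ⟨⟨y, hy⟩, -⟩ := hmem x hx
    refine ⟨y, ⟨x, hx, ?_⟩, u, Option.mem_unique hv (f.map_mul _ _ _ hy)⟩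
    rw [Option.mem_def.1 hy]; rfl
  · rintro ⟨_, ⟨x, hx, rfl⟩, u, rfl⟩
    obtain ⟨⟨y, hy⟩, hxS⟩ := hmem x hx
    refine ⟨x * u, fg_mul_mem hS hxS u, ?_⟩
    have := f.map_mul _ _ u hy
    rw [Option.mem_def.1 hy]; exact this

/-- Composition of partial functions: `f * g` is `g` followed by `f`. -/
instance : Mul (DMonoid n) where
  mul f g :=
    { toPEquiv := g.toPEquiv.trans f.toPEquiv
      source_fg := by
        have h := fg_image g⁻¹ f.source_fg
        convert h using 1
        ext w
        simp only [source, Set.mem_ofPred_eq, PEquiv.mem_trans]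
        constructor
        · rintro ⟨v, b, hb, hv⟩; exact ⟨b, ⟨v, hv⟩, (PEquiv.mem_iff_mem _).2 hb⟩
        · rintro ⟨b, ⟨v, hv⟩, hb⟩; exact ⟨v, b, (PEquiv.mem_iff_mem _).1 hb, hv⟩
      target_fg := by
        have h := fg_image f g.target_fg
        convert h using 1
        ext w
        simp only [target, Set.mem_ofPred_eq, PEquiv.mem_trans]
        constructor
        · rintro ⟨v, b, hb, hv⟩; exact ⟨b, ⟨v, hb⟩, hv⟩
        · rintro ⟨b, ⟨v, hv⟩, hb⟩; exact ⟨v, b, hv, hb⟩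
      map_mul := by
        intro r v s h
        rw [PEquiv.mem_trans] at h ⊢
        obtain ⟨b, hb, hv⟩ := h
        exact ⟨b * s, g.map_mul _ _ _ hb, f.map_mul _ _ _ hv⟩ }

/-- The identity function on the free monoid. -/
instance : One (DMonoid n) where
  one :=
    { toPEquiv := PEquiv.refl _
      source_fg := ⟨{1}, by ext w; simp [source]⟩
      target_fg := ⟨{1}, by ext w; simp [target]⟩
      map_mul := by intro r v s h; simp_all }

/-- The empty partial function. -/
instance : Zero (DMonoid n) where
  zero :=
    { toPEquiv := ⊥
      source_fg := ⟨∅, by ext w; simp [source]⟩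
      target_fg := ⟨∅, by ext w; simp [target]⟩
      map_mul := by intro r v s h; simp_all }

theorem mul_toPEquiv (f g : DMonoid n) : (f * g).toPEquiv = g.toPEquiv.trans f.toPEquiv := rfl

theorem inv_toPEquiv (f : DMonoid n) : (f⁻¹).toPEquiv = f.toPEquiv.symm := rfl

theorem one_toPEquiv : (1 : DMonoid n).toPEquiv = PEquiv.refl _ := rfl

theorem zero_toPEquiv : (0 : DMonoid n).toPEquiv = ⊥ := rfl

instance : MonoidWithZero (DMonoid n) where
  mul_assoc f g h := DMonoid.ext (PEquiv.trans_assoc _ _ _).symm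
  one_mul f := DMonoid.ext (PEquiv.trans_refl _)
  mul_one f := DMonoid.ext (PEquiv.refl_trans _)
  zero_mul f := DMonoid.ext (PEquiv.trans_bot _)
  mul_zero f := DMonoid.ext (PEquiv.bot_trans _)

theorem idem_apply {e : DMonoid n} (he : e * e = e) {w v : Words n} (h : v ∈ e.toPEquiv w) :
    v = w := by
  have h1 : v ∈ (e * e).toPEquiv w := by rw [he]; exact h
  rw [mul_toPEquiv, PEquiv.mem_trans] at h1
  obtain ⟨b, hb, hv⟩ := h1
  have h2 : v = b := Option.mem_unique h hb
  subst h2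
  exact e.toPEquiv.inj hv h

theorem mem_idem_mul {e f : DMonoid n} (he : e * e = e) (hf : f * f = f) {w v : Words n} :
    v ∈ (e * f).toPEquiv w ↔ v = w ∧ w ∈ e.toPEquiv w ∧ w ∈ f.toPEquiv w := by
  rw [mul_toPEquiv, PEquiv.mem_trans]
  constructor
  · rintro ⟨b, hb, hv⟩
    obtain rfl := idem_apply hf hb
    obtain rfl := idem_apply he hv
    exact ⟨rfl, hv, hb⟩
  · rintro ⟨rfl, h1, h2⟩
    exact ⟨_, h2, h1⟩

theorem idem_comm_D {e f : DMonoid n} (he : e * e = e) (hf : f * f = f) : e * f = f * e := by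
  apply DMonoid.ext
  apply PEquiv.ext
  intro w
  apply Option.ext
  intro v
  have h := mem_idem_mul he hf (w := w) (v := v)
  have h' := mem_idem_mul hf he (w := w) (v := v)
  simp only [Option.mem_def] at h h'
  rw [h, h', and_comm (a := e.toPEquiv w = some w)]

theorem mul_inv_mul_D (f : DMonoid n) : f * f⁻¹ * f = f := by
  apply DMonoid.ext
  apply PEquiv.ext
  intro w
  apply Option.ext
  intro v
  change v ∈ (f.toPEquiv.trans (f.toPEquiv.symm.trans f.toPEquiv)) w ↔ v ∈ f.toPEquiv w
  simp only [PEquiv.mem_trans, PEquiv.mem_iff_mem]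
  constructor
  · rintro ⟨b, hb, c, hc, hv⟩
    obtain rfl := f.toPEquiv.inj hb hc
    exact hv
  · intro h
    exact ⟨v, h, w, h, h⟩

theorem inv_inv_D (f : DMonoid n) : (f⁻¹)⁻¹ = f := rfl

theorem inv_mul_inv_D (f : DMonoid n) : f⁻¹ * f * f⁻¹ = f⁻¹ := mul_inv_mul_D f⁻¹

instance : InverseMonoidWithZero (DMonoid n) where
  mul_inv_mul := mul_inv_mul_D
  inv_mul_inv := inv_mul_inv_D
  eq_inv a _ h1 h2 := InverseMonoid.regular_inverse_unique (fun _ _ => idem_comm_D)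
    h1 h2 (mul_inv_mul_D a) (inv_mul_inv_D a)
  zero_mul := zero_mul
  mul_zero := mul_zero

instance : Nontrivial (DMonoid n) :=
  ⟨1, 0, fun h => by
    have h1 := congrArg (fun f : DMonoid n => f.toPEquiv 1) h
    simp [one_toPEquiv, zero_toPEquiv] at h1⟩

end DMonoid

/-- The Cuntz inverse monoid `Cₙ`, the quotient of `Dₙ` by the Lenz congruence. -/
abbrev CuntzInverseMonoid (n : ℕ) : Type := (InverseMonoid.lenzCon (DMonoid n)).Quotient

instance (n : ℕ) : InverseMonoidWithZero (CuntzInverseMonoid n) :=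
  InverseMonoid.quotientInverseMonoidWithZero _

/-- The Thompson group `G_{n,1}`, the quotient of the inverse monoid of essential elements of `Dₙ`
by its minimum group congruence. -/
abbrev ThompsonGroup (n : ℕ) : Type :=
  (InverseMonoid.sigma (InverseMonoid.essential (DMonoid n))).Quotient

/-! ### Products, inverses and the natural order in terms of graphs. -/

namespace DMonoid

open Cuntz InverseMonoid Filter

variable {n : ℕ}

/-! A right ideal is finitely generated exactly when, beyond some length, membership of a word is
decided by any one of its extensions (`isFGRightIdeal_iff`). The Lenz congruence therefore forgets
precisely the short words: `s ≡ t` if and only if the graphs of `s` and `t` coincide over all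
sufficiently long words (`lenz_iff`). So `Cₙ` consists of germs of partial bijections at infinity,
and its natural order is eventual inclusion of graphs (`mk_natLE_mk`).

The Boolean structure is then set-theoretic. Meets are intersections of graphs, and joins are
unions: by right cancellation, representatives of compatible classes agree exactly and not only on
long words (`agree_of_compatible`). Idempotents are finitely generated right ideals modulo finitely
many words, and the complement of such an ideal becomes one again once its short words are dropped
(`exists_compl`).

For the units, `a` is essential if and only if its domain and image contain all long words, that is,
if and only if its class is invertible (`isEssential_iff_mk`). Two essential elements have the same
class exactly when they have a common essential restriction, which is `σ` (`sigma_eq_ker`); the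
first isomorphism theorem finishes. -/

theorem mem_mul {f g : DMonoid n} {w v : Words n} :
    v ∈ (f * g).toPEquiv w ↔ ∃ b, b ∈ g.toPEquiv w ∧ v ∈ f.toPEquiv b :=
  PEquiv.mem_trans _ _ _ _

theorem mem_inv {f : DMonoid n} {w v : Words n} :
    v ∈ (f⁻¹).toPEquiv w ↔ w ∈ f.toPEquiv v :=
  PEquiv.mem_iff_mem _

theorem mem_one_iff {w v : Words n} : v ∈ (1 : DMonoid n).toPEquiv w ↔ v = w := by
  rw [one_toPEquiv]
  simp [eq_comm]

theorem mem_dom {f : DMonoid n} {w v : Words n} :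
    v ∈ (f⁻¹ * f).toPEquiv w ↔ v = w ∧ w ∈ source f.toPEquiv := by
  rw [mem_mul]
  constructor
  · rintro ⟨b, hb, hv⟩
    exact ⟨f.toPEquiv.inj (mem_inv.1 hv) hb, b, hb⟩
  · rintro ⟨rfl, b, hb⟩
    exact ⟨b, hb, mem_inv.2 hb⟩

theorem ext_mem {f g : DMonoid n} (h : ∀ w v, v ∈ f.toPEquiv w ↔ v ∈ g.toPEquiv w) : f = g :=
  DMonoid.ext (PEquiv.ext fun w => Option.ext fun v => h w v)

theorem mem_mul_dom {a b : DMonoid n} {w v : Words n} :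
    v ∈ (b * (a⁻¹ * a)).toPEquiv w ↔ w ∈ source a.toPEquiv ∧ v ∈ b.toPEquiv w := by
  rw [mem_mul]
  constructor
  · rintro ⟨x, hx, hv⟩
    obtain ⟨rfl, hw⟩ := mem_dom.1 hx
    exact ⟨hw, hv⟩
  · rintro ⟨hw, hv⟩
    exact ⟨w, mem_dom.2 ⟨rfl, hw⟩, hv⟩

/-- The product `b * (a⁻¹ * a)` is the restriction of `b` to the source of `a`, so the natural order
is inclusion of graphs. -/
theorem natLE_iff {a b : DMonoid n} :
    NatLE a b ↔ ∀ w v, v ∈ a.toPEquiv w → v ∈ b.toPEquiv w := by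
  constructor
  · intro h w v hv
    rw [show a = b * (a⁻¹ * a) from h] at hv
    exact (mem_mul_dom.1 hv).2
  · intro h
    refine ext_mem fun w v => ?_
    rw [mem_mul_dom]
    refine ⟨fun hv => ⟨⟨v, hv⟩, h w v hv⟩, ?_⟩
    rintro ⟨⟨v', hv'⟩, hv⟩
    rwa [Option.mem_unique hv (h w v' hv')]

theorem exists_mem_of_ne_zero {a : DMonoid n} (h : a ≠ 0) : ∃ w v, v ∈ a.toPEquiv w := by
  by_contra hc
  push Not at hc
  refine h (ext_mem fun w v => ⟨fun hv => absurd hv (hc w v), fun hv => ?_⟩)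
  rw [zero_toPEquiv] at hv
  simp at hv

theorem ne_zero_of_mem {a : DMonoid n} {w v : Words n} (h : v ∈ a.toPEquiv w) : a ≠ 0 := by
  rintro rfl
  rw [zero_toPEquiv] at h
  simp at h

/-! ### Finitely generated right ideals. -/

/-- Right ideals of a free monoid of finite rank are finitely generated exactly when membership of
a sufficiently long word is detected by its extensions. -/
theorem isFGRightIdeal_iff {R : Set (Words n)} : IsFGRightIdeal R ↔
    (∀ w ∈ R, ∀ u, w * u ∈ R) ∧ ∃ N, ∀ w u : Words n, N ≤ w.length → w * u ∈ R → w ∈ R := by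
  constructor
  · intro hR
    refine ⟨fun w hw u => fg_mul_mem hR hw u, ?_⟩
    obtain ⟨X, rfl⟩ := hR
    -- The bound is the greatest length of a generator: a generator that is a prefix of `w * u` is
    -- then already a prefix of `w`.
    refine ⟨X.sup FreeMonoid.length, fun w u hw => ?_⟩
    rintro ⟨x, hx, v, hv⟩
    have hxw : x.length ≤ w.length := (Finset.le_sup hx).trans hw
    rcases prefix_comparable hv with ⟨p, hp⟩ | ⟨p, hp⟩
    · exact ⟨x, hx, p, hp⟩
    · rw [hp, FreeMonoid.length_mul] at hxw
      have hp1 : p = 1 := FreeMonoid.length_eq_zero.1 (by omega)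
      exact ⟨x, hx, 1, by rw [hp, hp1, mul_one, mul_one]⟩
  · rintro ⟨hR, N, hN⟩
    -- The words of `R` of length at most `N` serve as generators: a longer word of `R` has its
    -- prefix of length `N` in `R`.
    have hfin : {w : Words n | w.length ≤ N ∧ w ∈ R}.Finite :=
      (List.finite_length_le (Fin n) N).subset fun w hw => hw.1
    refine ⟨hfin.toFinset, ?_⟩
    ext w
    simp only [Set.Finite.mem_toFinset, Set.mem_ofPred_eq]
    constructor
    · intro hw
      by_cases hl : w.length ≤ N
      · exact ⟨w, ⟨hl, hw⟩, 1, (mul_one w).symm⟩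
      · have hsplit : w = FreeMonoid.ofList (w.toList.take N) * FreeMonoid.ofList (w.toList.drop N) :=
          (List.take_append_drop N w.toList).symm
        have hlen : (FreeMonoid.ofList (w.toList.take N)).length = N := by
          have h' : N < w.toList.length := not_le.1 hl
          exact List.length_take_of_le h'.le
        exact ⟨_, ⟨hlen.le, hN _ _ hlen.ge (hsplit ▸ hw)⟩, _, hsplit⟩
    · rintro ⟨x, ⟨-, hx⟩, u, rfl⟩
      exact hR x hx u

theorem fg_union {R S : Set (Words n)} (hR : IsFGRightIdeal R) (hS : IsFGRightIdeal S) :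
    IsFGRightIdeal (R ∪ S) := by
  classical
  obtain ⟨X, rfl⟩ := hR
  obtain ⟨Y, rfl⟩ := hS
  refine ⟨X ∪ Y, ?_⟩
  ext w
  simp only [Set.mem_union, Set.mem_ofPred_eq, Finset.mem_union, or_and_right, exists_or]

theorem fg_principal (r : Words n) : IsFGRightIdeal {w | ∃ u, w = r * u} :=
  ⟨{r}, by ext w; simp⟩

/-- Words of length at least `N` form a finitely generated right ideal. -/
theorem fg_length (N : ℕ) : IsFGRightIdeal {w : Words n | N ≤ w.length} := by
  refine isFGRightIdeal_iff.2 ⟨fun w hw u => ?_, N, fun w u hw _ => hw⟩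
  simp only [Set.mem_ofPred_eq, FreeMonoid.length_mul] at hw ⊢
  omega

/-! ### Elements of `Dₙ` built from their graphs. -/

open Classical in
/-- The element of `Dₙ` whose graph is a given relation. -/
noncomputable def ofRel (r : Words n → Words n → Prop)
    (hfun : ∀ w v v', r w v → r w v' → v = v') (hinj : ∀ w w' v, r w v → r w' v → w = w')
    (hmul : ∀ w v s, r w v → r (w * s) (v * s)) (hfg : IsFGRightIdeal {w | ∃ v, r w v}) :
    DMonoid n :=
  have hto : ∀ w v, (v ∈ if h : ∃ v, r w v then some h.choose else none) ↔ r w v := by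
    intro w v
    split_ifs with h
    · rw [Option.mem_some_iff]
      exact ⟨fun e => e ▸ h.choose_spec, fun hv => hfun _ _ _ h.choose_spec hv⟩
    · simp only [Option.mem_def, reduceCtorEq, false_iff]
      exact fun hv => h ⟨v, hv⟩
  have hinv : ∀ v w, (w ∈ if h : ∃ w, r w v then some h.choose else none) ↔ r w v := by
    intro v w
    split_ifs with h
    · rw [Option.mem_some_iff]
      exact ⟨fun e => e ▸ h.choose_spec, fun hv => hinj _ _ _ h.choose_spec hv⟩
    · simp only [Option.mem_def, reduceCtorEq, false_iff]
      exact fun hv => h ⟨w, hv⟩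
  { toPEquiv :=
      { toFun := fun w => if h : ∃ v, r w v then some h.choose else none
        invFun := fun v => if h : ∃ w, r w v then some h.choose else none
        inv := fun w v => (hinv v w).trans (hto w v).symm }
    source_fg := by
      convert hfg using 1
      ext w
      exact exists_congr (hto w)
    -- The images of generators of the domain generate the image, so finite generation need only be
    -- assumed for the domain.
    target_fg := by
      obtain ⟨X, hX⟩ := hfg
      have hx : ∀ x ∈ X, ∃ v, r x v := by
        intro x hx
        have : x ∈ {w | ∃ v, r w v} := by rw [hX]; exact ⟨x, hx, 1, (mul_one x).symm⟩
        exact this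
      refine ⟨X.attach.image fun x => (hx x.1 x.2).choose, ?_⟩
      ext v
      simp only [target, Set.mem_ofPred_eq, Finset.mem_image, Finset.mem_attach, true_and]
      constructor
      · rintro ⟨w, hw⟩
        have hw' : r w v := (hto w v).1 hw
        have hwX : w ∈ {w | ∃ v, r w v} := ⟨v, hw'⟩
        rw [hX] at hwX
        obtain ⟨x, hxX, u, rfl⟩ := hwX
        exact ⟨_, ⟨⟨x, hxX⟩, rfl⟩, u,
          hfun _ _ _ hw' (hmul _ _ u (hx x hxX).choose_spec)⟩
      · rintro ⟨_, ⟨⟨x, hxX⟩, rfl⟩, u, rfl⟩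
        exact ⟨x * u, (hto _ _).2 (hmul _ _ u (hx x hxX).choose_spec)⟩
    map_mul := fun w v s h => (hto _ _).2 (hmul _ _ _ ((hto w v).1 h)) }

theorem mem_ofRel {r : Words n → Words n → Prop} {hfun hinj hmul hfg} {w v : Words n} :
    v ∈ (ofRel r hfun hinj hmul hfg).toPEquiv w ↔ r w v := by
  classical
  change (v ∈ if h : ∃ v, r w v then some h.choose else none) ↔ r w v
  split_ifs with h
  · rw [Option.mem_some_iff]
    exact ⟨fun e => e ▸ h.choose_spec, fun hv => hfun _ _ _ h.choose_spec hv⟩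
  · simp only [Option.mem_def, reduceCtorEq, false_iff]
    exact fun hv => h ⟨v, hv⟩

/-- The identity on a finitely generated right ideal. -/
noncomputable def idOn (R : Set (Words n)) (hR : IsFGRightIdeal R) : DMonoid n :=
  ofRel (fun w v => w ∈ R ∧ v = w) (fun _ _ _ h h' => h.2.trans h'.2.symm)
    (fun _ _ _ h h' => h.2.symm.trans h'.2)
    (fun _ _ s h => ⟨fg_mul_mem hR h.1 s, h.2 ▸ rfl⟩) (by simpa using hR)

theorem mem_idOn {R : Set (Words n)} {hR : IsFGRightIdeal R} {w v : Words n} :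
    v ∈ (idOn R hR).toPEquiv w ↔ w ∈ R ∧ v = w := mem_ofRel

theorem idOn_idem {R : Set (Words n)} {hR : IsFGRightIdeal R} :
    IsIdempotentElem (idOn R hR) := by
  refine ext_mem fun w v => ?_
  simp only [mem_mul, mem_idOn]
  constructor
  · rintro ⟨b, ⟨hw, rfl⟩, hv⟩
    exact hv
  · rintro ⟨hw, rfl⟩
    exact ⟨_, ⟨hw, rfl⟩, hw, rfl⟩

theorem mem_mul_idOn {a : DMonoid n} {R : Set (Words n)} {hR : IsFGRightIdeal R} {w v : Words n} :
    v ∈ (a * idOn R hR).toPEquiv w ↔ w ∈ R ∧ v ∈ a.toPEquiv w := by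
  simp only [mem_mul, mem_idOn]
  constructor
  · rintro ⟨b, ⟨hw, rfl⟩, hv⟩
    exact ⟨hw, hv⟩
  · rintro ⟨hw, hv⟩
    exact ⟨_, ⟨hw, rfl⟩, hv⟩

/-- The intersection of two partial bijections. -/
noncomputable def inter (a b : DMonoid n) : DMonoid n :=
  ofRel (fun w v => v ∈ a.toPEquiv w ∧ v ∈ b.toPEquiv w)
    (fun _ _ _ h h' => Option.mem_unique h.1 h'.1)
    (fun _ _ _ h h' => a.toPEquiv.inj h.1 h'.1)
    (fun _ _ s h => ⟨a.map_mul _ _ s h.1, b.map_mul _ _ s h.2⟩) <| by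
      obtain ⟨-, N, hN⟩ := isFGRightIdeal_iff.1 a.source_fg
      obtain ⟨-, N', hN'⟩ := isFGRightIdeal_iff.1 b.source_fg
      -- Beyond both thresholds, agreement of `a` and `b` at `w * u` forces both to be defined at
      -- `w`; cancelling `u` shows that they agree there.
      refine isFGRightIdeal_iff.2 ⟨?_, max N N', ?_⟩
      · rintro w ⟨v, h⟩ u
        exact ⟨v * u, a.map_mul _ _ u h.1, b.map_mul _ _ u h.2⟩
      · rintro w u hw ⟨v, hv, hv'⟩
        obtain ⟨x, hx⟩ := hN w u (le_of_max_le_left hw) ⟨v, hv⟩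
        obtain ⟨y, hy⟩ := hN' w u (le_of_max_le_right hw) ⟨v, hv'⟩
        have h1 := Option.mem_unique (a.map_mul _ _ u hx) hv
        have h2 := Option.mem_unique (b.map_mul _ _ u hy) hv'
        obtain rfl : x = y := mul_right_cancel (h1.trans h2.symm)
        exact ⟨x, hx, hy⟩

theorem mem_inter {a b : DMonoid n} {w v : Words n} :
    v ∈ (inter a b).toPEquiv w ↔ v ∈ a.toPEquiv w ∧ v ∈ b.toPEquiv w := mem_ofRel

/-- The union of two partial bijections that agree on common arguments and on common values. -/
noncomputable def union (a b : DMonoid n)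
    (h1 : ∀ w v v', v ∈ a.toPEquiv w → v' ∈ b.toPEquiv w → v = v')
    (h2 : ∀ w w' v, v ∈ a.toPEquiv w → v ∈ b.toPEquiv w' → w = w') : DMonoid n :=
  ofRel (fun w v => v ∈ a.toPEquiv w ∨ v ∈ b.toPEquiv w)
    (by
      rintro w v v' (h | h) (h' | h')
      exacts [Option.mem_unique h h', h1 _ _ _ h h', (h1 _ _ _ h' h).symm, Option.mem_unique h h'])
    (by
      rintro w w' v (h | h) (h' | h')
      exacts [a.toPEquiv.inj h h', h2 _ _ _ h h', (h2 _ _ _ h' h).symm, b.toPEquiv.inj h h'])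
    (fun _ _ s h => h.imp (a.map_mul _ _ s) (b.map_mul _ _ s)) (by
      convert fg_union a.source_fg b.source_fg using 1
      ext w
      exact exists_or)

theorem mem_union {a b : DMonoid n} {h1 h2} {w v : Words n} :
    v ∈ (union a b h1 h2).toPEquiv w ↔ v ∈ a.toPEquiv w ∨ v ∈ b.toPEquiv w := mem_ofRel

/-! ### Germs at infinity and the Lenz congruence. -/

/-- The filter of sets of words containing all sufficiently long words. -/
def longWords (n : ℕ) : Filter (Words n) := comap FreeMonoid.length atTop

theorem eventually_longWords {P : Words n → Prop} :
    (∀ᶠ w in longWords n, P w) ↔ ∃ N, ∀ w : Words n, N ≤ w.length → P w := by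
  rw [longWords, eventually_comap, eventually_atTop]
  constructor
  · rintro ⟨N, h⟩
    exact ⟨N, fun w hw => h _ hw w rfl⟩
  · rintro ⟨N, h⟩
    exact ⟨N, fun _ hb w hw => h w (hw ▸ hb)⟩

/-- Every word extends to a long one. -/
theorem exists_extension (hn : 2 ≤ n) {P : Words n → Prop} (h : ∀ᶠ w in longWords n, P w)
    (r : Words n) : ∃ u, P (r * u) := by
  obtain ⟨N, hN⟩ := eventually_longWords.1 h
  refine ⟨FreeMonoid.ofList (List.replicate N ⟨0, by omega⟩), hN _ ?_⟩
  rw [FreeMonoid.length_mul]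
  have : (FreeMonoid.ofList (List.replicate N (⟨0, by omega⟩ : Fin n))).length = N :=
    List.length_replicate
  omega

/-- Inclusion of graphs over all sufficiently long words. -/
def GermLE (a b : DMonoid n) : Prop :=
  ∀ᶠ w in longWords n, ∀ v ∈ a.toPEquiv w, v ∈ b.toPEquiv w

/-- A non-zero `x ≤ s` is defined at arbitrarily long words, where `s` lies in `t`, so `inter x t`
is non-zero. Conversely, test on the restriction of `s` to the principal ideal of a word `r` beyond
the threshold of the source of `t`: some extension `r * u` has the same image under `s` and `t`, the
threshold puts `r` in the source of `t`, and cancelling `u` gives agreement at `r`. -/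
theorem germLE_iff_lenz_half (hn : 2 ≤ n) {s t : DMonoid n} : GermLE s t ↔
    ∀ x : DMonoid n, x ≠ 0 → NatLE x s → ∃ z : DMonoid n, z ≠ 0 ∧ NatLE z x ∧ NatLE z t := by
  constructor
  · intro h x hx hxs
    obtain ⟨w, v, hv⟩ := exists_mem_of_ne_zero hx
    obtain ⟨u, hu⟩ := exists_extension hn h w
    have hvu := x.map_mul _ _ u hv
    refine ⟨inter x t,
      ne_zero_of_mem (mem_inter.2 ⟨hvu, hu _ (natLE_iff.1 hxs _ _ hvu)⟩), ?_, ?_⟩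
    · exact natLE_iff.2 fun w v h => (mem_inter.1 h).1
    · exact natLE_iff.2 fun w v h => (mem_inter.1 h).2
  · intro h
    obtain ⟨-, N, hN⟩ := isFGRightIdeal_iff.1 t.source_fg
    refine eventually_longWords.2 ⟨N, fun r hr v hv => ?_⟩
    obtain ⟨z, hz0, hzx, hzt⟩ := h (s * idOn _ (fg_principal r))
      (ne_zero_of_mem (mem_mul_idOn.2 ⟨⟨1, (mul_one r).symm⟩, hv⟩))
      (natLE_of_eq_mul_idem idOn_idem rfl)
    obtain ⟨w, y, hy⟩ := exists_mem_of_ne_zero hz0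
    obtain ⟨⟨u, rfl⟩, hys⟩ := mem_mul_idOn.1 (natLE_iff.1 hzx _ _ hy)
    have hyt := natLE_iff.1 hzt _ _ hy
    obtain ⟨v', hv'⟩ := hN r u hr ⟨y, hyt⟩
    have h1 := Option.mem_unique (s.map_mul _ _ u hv) hys
    have h2 := Option.mem_unique (t.map_mul _ _ u hv') hyt
    rwa [mul_right_cancel (h1.trans h2.symm)]

theorem lenz_iff (hn : 2 ≤ n) {s t : DMonoid n} :
    Lenz s t ↔ GermLE s t ∧ GermLE t s :=
  (and_congr (germLE_iff_lenz_half hn) (germLE_iff_lenz_half hn)).symm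

end DMonoid

/-! ### The natural order on a general inverse monoid. -/

namespace InverseMonoid

variable {M : Type*} [InverseMonoid M]

theorem natLE_antisymm {a b : M} (h1 : NatLE a b) (h2 : NatLE b a) : a = b := by
  have h1' : a = b * (a⁻¹ * a) := h1
  have h2' : b = a * (b⁻¹ * b) := h2
  calc a = b * (a⁻¹ * a) := h1'
    _ = a * (b⁻¹ * b) * (a⁻¹ * a) := by rw [← h2']
    _ = a * (a⁻¹ * a) * (b⁻¹ * b) := by
      rw [mul_assoc, idem_comm (dom_idem b) (dom_idem a), ← mul_assoc]
    _ = b := by rw [← mul_assoc a, mul_inv_mul, ← h2']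

theorem IsJoin.unique {a b c d : M} (h : IsJoin a b c) (h' : IsJoin a b d) : c = d :=
  natLE_antisymm (h.2.2 d h'.1 h'.2.1) (h'.2.2 c h.1 h.2.1)

/-- This turns idempotency of a class in `Cₙ` into a germ inclusion in the identity. -/
theorem natLE_one_iff {e : M} : NatLE e 1 ↔ IsIdempotentElem e := by
  constructor
  · intro h
    have h' : e = 1 * (e⁻¹ * e) := h
    rw [one_mul] at h'
    rw [h']
    exact dom_idem e
  · intro h
    exact natLE_of_eq_mul_idem h (one_mul e).symm

end InverseMonoid

/-! ### Order, joins and meets in `Cₙ`. -/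

namespace CuntzInverseMonoid

open Cuntz InverseMonoid Filter DMonoid

variable {n : ℕ}

/-- The class of an element of `Dₙ` in the Cuntz inverse monoid. -/
def mk (a : DMonoid n) : CuntzInverseMonoid n := (a : (lenzCon (DMonoid n)).Quotient)

theorem mk_surjective : Function.Surjective (mk (n := n)) := Quotient.mk_surjective

theorem mk_mul (a b : DMonoid n) : mk (a * b) = mk a * mk b := rfl

theorem mk_inv (a : DMonoid n) : mk a⁻¹ = (mk a)⁻¹ := rfl

theorem mk_one : mk (1 : DMonoid n) = 1 := rfl

theorem mk_eq_mk (hn : 2 ≤ n) {a b : DMonoid n} :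
    mk a = mk b ↔ GermLE a b ∧ GermLE b a :=
  (Con.eq _).trans (lenz_iff hn)

/-- The order says that `a` and the restriction of `b` to the source of `a` have the same germ,
which amounts to eventual inclusion of graphs. -/
theorem mk_natLE_mk (hn : 2 ≤ n) {a b : DMonoid n} : NatLE (mk a) (mk b) ↔ GermLE a b := by
  change mk a = mk (b * (a⁻¹ * a)) ↔ _
  rw [mk_eq_mk hn]
  constructor
  · rintro ⟨h, -⟩
    filter_upwards [h] with w hw v hv
    exact (mem_mul_dom.1 (hw v hv)).2
  · intro h
    constructor
    · filter_upwards [h] with w hw v hv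
      exact mem_mul_dom.2 ⟨⟨v, hv⟩, hw v hv⟩
    · filter_upwards [h] with w hw v hv
      obtain ⟨⟨v', hv'⟩, hv⟩ := mem_mul_dom.1 hv
      rwa [Option.mem_unique hv (hw v' hv')]

theorem isIdempotentElem_mk (hn : 2 ≤ n) {a : DMonoid n} :
    IsIdempotentElem (mk a) ↔ ∀ᶠ w in longWords n, ∀ v ∈ a.toPEquiv w, v = w := by
  rw [← natLE_one_iff, ← mk_one, mk_natLE_mk hn]
  simp only [GermLE, mem_one_iff]

theorem isJoin_mk (hn : 2 ≤ n) {a b c : DMonoid n}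
    (h : ∀ w v, v ∈ c.toPEquiv w ↔ v ∈ a.toPEquiv w ∨ v ∈ b.toPEquiv w) :
    IsJoin (mk a) (mk b) (mk c) := by
  refine ⟨(mk_natLE_mk hn).2 (.of_forall fun w v hv => (h w v).2 (.inl hv)),
    (mk_natLE_mk hn).2 (.of_forall fun w v hv => (h w v).2 (.inr hv)), ?_⟩
  intro d ha hb
  obtain ⟨d, rfl⟩ := mk_surjective d
  rw [mk_natLE_mk hn] at ha hb ⊢
  filter_upwards [ha, hb] with w h1 h2 v hv
  exact ((h w v).1 hv).elim (h1 v) (h2 v)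

theorem isMeet_mk (hn : 2 ≤ n) (a b : DMonoid n) : IsMeet (mk a) (mk b) (mk (inter a b)) := by
  refine ⟨(mk_natLE_mk hn).2 (.of_forall fun w v hv => (mem_inter.1 hv).1),
    (mk_natLE_mk hn).2 (.of_forall fun w v hv => (mem_inter.1 hv).2), ?_⟩
  intro d ha hb
  obtain ⟨d, rfl⟩ := mk_surjective d
  rw [mk_natLE_mk hn] at ha hb ⊢
  filter_upwards [ha, hb] with w h1 h2 v hv
  exact mem_inter.2 ⟨h1 v hv, h2 v hv⟩

/-- Elements with compatible classes agree on common arguments. -/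
theorem agree_of_compatible (hn : 2 ≤ n) {a b : DMonoid n} (h : Compatible (mk a) (mk b))
    (w v v' : Words n) (hv : v ∈ a.toPEquiv w) (hv' : v' ∈ b.toPEquiv w) : v = v' := by
  have h2 : IsIdempotentElem (mk (a * b⁻¹)) := h.2
  -- Idempotency of the class controls `a * b⁻¹` on long words only. It sends `v' * u` to `v * u`,
  -- so for long `v' * u` these are equal, and cancelling `u` gives exact agreement.
  obtain ⟨u, hu⟩ := exists_extension hn ((isIdempotentElem_mk hn).1 h2) v'
  refine mul_right_cancel (hu (v * u) (mem_mul.2 ⟨w * u, ?_, a.map_mul _ _ u hv⟩))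
  exact mem_inv.2 (b.map_mul _ _ u hv')

/-- Elements with compatible classes agree on common values. -/
theorem agree_inv_of_compatible (hn : 2 ≤ n) {a b : DMonoid n} (h : Compatible (mk a) (mk b))
    (w w' v : Words n) (hv : v ∈ a.toPEquiv w) (hv' : v ∈ b.toPEquiv w') : w = w' := by
  have h1 : IsIdempotentElem (mk (a⁻¹ * b)) := h.1
  obtain ⟨u, hu⟩ := exists_extension hn ((isIdempotentElem_mk hn).1 h1) w'
  refine mul_right_cancel (hu (w * u) (mem_mul.2 ⟨v * u, b.map_mul _ _ u hv', ?_⟩))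
  exact mem_inv.2 (a.map_mul _ _ u hv)

/-- Composition of relations distributes over unions of graphs. Since joins are unique, it suffices
to treat the join represented by the union. -/
theorem isDistributive (hn : 2 ≤ n) : IsDistributive (CuntzInverseMonoid n) := by
  have join : ∀ a b : DMonoid n, Compatible (mk a) (mk b) →
      ∃ c : DMonoid n, ∀ w v, v ∈ c.toPEquiv w ↔ v ∈ a.toPEquiv w ∨ v ∈ b.toPEquiv w :=
    fun a b h => ⟨union a b (agree_of_compatible hn h) (agree_inv_of_compatible hn h),
      fun _ _ => mem_union⟩
  refine ⟨fun a b h => ?_, fun s a b c h hc => ?_, fun s a b c h hc => ?_⟩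
  · obtain ⟨a, rfl⟩ := mk_surjective a
    obtain ⟨b, rfl⟩ := mk_surjective b
    obtain ⟨c, hc⟩ := join a b h
    exact ⟨mk c, isJoin_mk hn hc⟩
  · obtain ⟨a, rfl⟩ := mk_surjective a
    obtain ⟨b, rfl⟩ := mk_surjective b
    obtain ⟨s, rfl⟩ := mk_surjective s
    obtain ⟨d, hd⟩ := join a b h
    rw [hc.unique (isJoin_mk hn hd), ← mk_mul, ← mk_mul, ← mk_mul]
    refine isJoin_mk hn fun w v => ?_
    simp only [mem_mul, hd, or_and_right, exists_or]
  · obtain ⟨a, rfl⟩ := mk_surjective a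
    obtain ⟨b, rfl⟩ := mk_surjective b
    obtain ⟨s, rfl⟩ := mk_surjective s
    obtain ⟨d, hd⟩ := join a b h
    rw [hc.unique (isJoin_mk hn hd), ← mk_mul, ← mk_mul, ← mk_mul]
    refine isJoin_mk hn fun w v => ?_
    simp only [mem_mul, hd, and_or_left, exists_or]

/-! ### The Boolean algebra of idempotents. -/

/-- The idempotent of the Cuntz inverse monoid given by a finitely generated right ideal. -/
noncomputable def idem (R : {R : Set (Words n) // IsFGRightIdeal R}) :
    {e : CuntzInverseMonoid n // IsIdempotentElem e} :=
  ⟨mk (idOn R.1 R.2), congrArg mk (idOn_idem (hR := R.2))⟩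

theorem idem_natLE_idem (hn : 2 ≤ n) {R S : {R : Set (Words n) // IsFGRightIdeal R}} :
    NatLE (idem R : CuntzInverseMonoid n) (idem S) ↔ ∀ᶠ w in longWords n, w ∈ R.1 → w ∈ S.1 := by
  refine (mk_natLE_mk hn).trans (eventually_congr (.of_forall fun w => ?_))
  simp only [mem_idOn]
  exact ⟨fun h hw => (h w ⟨hw, rfl⟩).1, fun h v hv => ⟨h hv.1, hv.2⟩⟩

/-- A representative `a` of an idempotent class need not be idempotent, but its class equals that of
`a⁻¹ * a`, the identity on the source of `a`. -/
theorem idem_surjective : Function.Surjective (idem (n := n)) := by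
  rintro ⟨e, he⟩
  obtain ⟨a, rfl⟩ := mk_surjective e
  refine ⟨⟨_, a.source_fg⟩, Subtype.ext ?_⟩
  have h1 : idOn _ a.source_fg = a⁻¹ * a :=
    ext_mem fun w v => by rw [mem_idOn, mem_dom, and_comm]
  change mk (idOn _ a.source_fg) = mk a
  rw [h1, mk_mul, mk_inv, inv_of_idem he, he]

/-- Every finitely generated right ideal has a complement up to finitely many words. -/
theorem exists_compl (R : Set (Words n)) (hR : IsFGRightIdeal R) :
    ∃ S : Set (Words n), IsFGRightIdeal S ∧ ∀ᶠ w in longWords n, w ∈ S ↔ w ∉ R := by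
  obtain ⟨hmul, N, hN⟩ := isFGRightIdeal_iff.1 hR
  -- Beyond the threshold `N` of `R`, no extension of a word outside `R` enters `R`; discarding
  -- shorter words makes the complement a right ideal.
  refine ⟨{w | N ≤ w.length ∧ w ∉ R}, isFGRightIdeal_iff.2 ⟨?_, N, ?_⟩,
    eventually_longWords.2 ⟨N, fun w hw => and_iff_right hw⟩⟩
  · rintro w ⟨hw, hwR⟩ u
    exact ⟨by rw [FreeMonoid.length_mul]; omega, fun h => hwR (hN w u hw h)⟩
  · rintro w u hw ⟨-, h⟩
    exact ⟨hw, fun hwR => h (hmul w hwR u)⟩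

/-- The Boolean algebra of idempotents of the Cuntz inverse monoid. -/
@[reducible] noncomputable def idemBooleanAlgebra (hn : 2 ≤ n) :
    BooleanAlgebra {e : CuntzInverseMonoid n // IsIdempotentElem e} :=
  -- A chosen ideal for each idempotent. It is determined only up to finitely many words, so the
  -- axioms are checked on long words.
  let supp := Function.surjInv (idem_surjective (n := n))
  have hsupp : ∀ e, idem (supp e) = e := Function.surjInv_eq _
  have le_idem : ∀ (e : {e : CuntzInverseMonoid n // IsIdempotentElem e}) R, NatLE (e : CuntzInverseMonoid n) (idem R) ↔
      ∀ᶠ w in longWords n, w ∈ (supp e).1 → w ∈ R.1 := fun e R => by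
    rw [← idem_natLE_idem hn, hsupp]
  have idem_le : ∀ R (e : {e : CuntzInverseMonoid n // IsIdempotentElem e}), NatLE (idem R : CuntzInverseMonoid n) e ↔
      ∀ᶠ w in longWords n, w ∈ R.1 → w ∈ (supp e).1 := fun R e => by
    rw [← idem_natLE_idem hn, hsupp]
  have le_iff : ∀ e f : {e : CuntzInverseMonoid n // IsIdempotentElem e}, NatLE (e : CuntzInverseMonoid n) f ↔
      ∀ᶠ w in longWords n, w ∈ (supp e).1 → w ∈ (supp f).1 := fun e f => by
    rw [← idem_natLE_idem hn, hsupp, hsupp]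
  -- Needed where the result of one operation is fed into another, as in distributivity and the
  -- complement laws.
  have supp_idem : ∀ R, ∀ᶠ w in longWords n, w ∈ (supp (idem R)).1 ↔ w ∈ R.1 := fun R => by
    filter_upwards [(le_idem (idem R) R).1 (natLE_refl _),
      (idem_le R (idem R)).1 (natLE_refl _)] with w h1 h2 using ⟨h1, h2⟩
  { le := fun e f => NatLE (e : CuntzInverseMonoid n) f
    le_refl := fun e => natLE_refl _
    le_trans := fun _ _ _ => natLE_trans
    le_antisymm := fun _ _ h1 h2 => Subtype.ext (natLE_antisymm h1 h2)
    sup := fun e f => idem ⟨_, fg_union (supp e).2 (supp f).2⟩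
    le_sup_left := fun e f => (le_idem _ _).2 (.of_forall fun w h => .inl h)
    le_sup_right := fun e f => (le_idem _ _).2 (.of_forall fun w h => .inr h)
    sup_le := fun e f g h1 h2 => (idem_le _ _).2 <| by
      filter_upwards [(le_iff _ _).1 h1, (le_iff _ _).1 h2] with w h1 h2 h using h.elim h1 h2
    inf := fun e f => idem ⟨_, fg_inter (supp e).2 (supp f).2⟩
    inf_le_left := fun e f => (idem_le _ _).2 (.of_forall fun w h => h.1)
    inf_le_right := fun e f => (idem_le _ _).2 (.of_forall fun w h => h.2)
    le_inf := fun e f g h1 h2 => (le_idem _ _).2 <| by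
      filter_upwards [(le_iff _ _).1 h1, (le_iff _ _).1 h2] with w h1 h2 h using ⟨h1 h, h2 h⟩
    le_sup_inf := fun e f g => (idem_natLE_idem hn).2 <| by
      filter_upwards [supp_idem ⟨_, fg_union (supp e).2 (supp f).2⟩,
        supp_idem ⟨_, fg_union (supp e).2 (supp g).2⟩,
        supp_idem ⟨_, fg_inter (supp f).2 (supp g).2⟩] with w h1 h2 h3
      rintro ⟨h, h'⟩
      rcases h1.1 h with h | hf
      · exact .inl h
      · rcases h2.1 h' with h | hg
        · exact .inl h
        · exact .inr (h3.2 ⟨hf, hg⟩)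
    -- Every word has length at least 0, so this ideal is the whole free monoid.
    top := idem ⟨_, fg_length 0⟩
    le_top := fun e => (le_idem _ _).2 (.of_forall fun w _ => Nat.zero_le _)
    bot := idem ⟨∅, ∅, by simp⟩
    bot_le := fun e => (idem_le _ _).2 (.of_forall fun w h => h.elim)
    compl := fun e => idem ⟨_, (exists_compl (supp e).1 (supp e).2).choose_spec.1⟩
    inf_compl_le_bot := fun e => (idem_natLE_idem hn).2 <| by
      have h := exists_compl (supp e).1 (supp e).2
      filter_upwards [supp_idem ⟨_, h.choose_spec.1⟩, h.choose_spec.2] with w h1 h2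
      rintro ⟨h, h'⟩
      exact h2.1 (h1.1 h') h
    top_le_sup_compl := fun e => (idem_natLE_idem hn).2 <| by
      have h := exists_compl (supp e).1 (supp e).2
      filter_upwards [supp_idem ⟨_, h.choose_spec.1⟩, h.choose_spec.2] with w h1 h2 _
      by_cases h : w ∈ (supp e).1
      · exact .inl h
      · exact .inr (h1.2 (h2.2 h)) }

theorem isBooleanMeet (hn : 2 ≤ n) : IsBooleanMeet (CuntzInverseMonoid n) where
  isBoolean := ⟨isDistributive hn, idemBooleanAlgebra hn, fun _ _ => Iff.rfl⟩
  exists_meet a b := by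
    obtain ⟨a, rfl⟩ := mk_surjective a
    obtain ⟨b, rfl⟩ := mk_surjective b
    exact ⟨_, isMeet_mk hn a b⟩

/-! ### Essential elements, units and the Thompson group. -/

/-- An idempotent of `Dₙ` is essential exactly when it fixes all sufficiently long words. -/
theorem isEssentialIdem_dom_iff (hn : 2 ≤ n) {a : DMonoid n} :
    IsEssentialIdem (dom a) ↔ ∀ᶠ w in longWords n, w ∈ source a.toPEquiv := by
  constructor
  · rintro ⟨-, -, h⟩
    obtain ⟨-, N, hN⟩ := isFGRightIdeal_iff.1 a.source_fg
    refine eventually_longWords.2 ⟨N, fun w hw => ?_⟩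
    -- Testing against the principal ideal of `w` finds an extension of `w` in the source of `a`;
    -- beyond the threshold, `w` itself is then there.
    have h0 : idOn _ (fg_principal w) ≠ 0 :=
      ne_zero_of_mem (mem_idOn.2 ⟨⟨1, (mul_one w).symm⟩, rfl⟩)
    obtain ⟨x, v, hx⟩ := exists_mem_of_ne_zero (h _ idOn_idem h0)
    obtain ⟨⟨u, rfl⟩, hd⟩ := mem_mul_idOn.1 hx
    exact hN w u hw (mem_dom.1 hd).2
  · intro h
    have key : ∀ f : DMonoid n, IsIdempotentElem f → f ≠ 0 → dom a * f ≠ 0 := by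
      intro f hf hf0
      obtain ⟨w, v, hv⟩ := exists_mem_of_ne_zero hf0
      obtain rfl := idem_apply hf hv
      obtain ⟨u, hu⟩ := exists_extension hn h v
      exact ne_zero_of_mem (mem_mul.2 ⟨v * u, f.map_mul _ _ u hv, mem_dom.2 ⟨rfl, hu⟩⟩)
    refine ⟨dom_idem a, fun h0 => key 1 (mul_one 1) one_ne_zero ?_, key⟩
    rw [h0, zero_mul]

theorem isEssentialIdem_dom_iff_mk (hn : 2 ≤ n) {a : DMonoid n} :
    IsEssentialIdem (dom a) ↔ (mk a)⁻¹ * mk a = 1 := by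
  rw [isEssentialIdem_dom_iff hn, ← mk_inv, ← mk_mul, ← mk_one, mk_eq_mk hn]
  constructor
  · intro h
    refine ⟨.of_forall fun w v hv => mem_one_iff.2 (mem_dom.1 hv).1, ?_⟩
    filter_upwards [h] with w hw v hv
    exact mem_dom.2 ⟨mem_one_iff.1 hv, hw⟩
  · rintro ⟨-, h⟩
    filter_upwards [h] with w hw
    exact (mem_dom.1 (hw w (mem_one_iff.2 rfl))).2

theorem isEssential_iff_mk (hn : 2 ≤ n) {a : DMonoid n} :
    IsEssential a ↔ (mk a)⁻¹ * mk a = 1 ∧ mk a * (mk a)⁻¹ = 1 := by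
  rw [IsEssential, ← dom_inv, isEssentialIdem_dom_iff_mk hn, isEssentialIdem_dom_iff_mk hn, mk_inv,
    inv_inv']

/-- The homomorphism from the essential elements of `Dₙ` to the units of the Cuntz inverse
monoid. -/
noncomputable def essentialToUnits (hn : 2 ≤ n) :
    essential (DMonoid n) →* (CuntzInverseMonoid n)ˣ where
  toFun a :=
    { val := mk a.1
      inv := (mk a.1)⁻¹
      val_inv := ((isEssential_iff_mk hn).1 a.2).2
      inv_val := ((isEssential_iff_mk hn).1 a.2).1 }
  map_one' := Units.ext rfl
  map_mul' _ _ := Units.ext rfl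

theorem essentialToUnits_surjective (hn : 2 ≤ n) :
    Function.Surjective (essentialToUnits hn) := by
  intro u
  obtain ⟨a, ha⟩ := mk_surjective (u : CuntzInverseMonoid n)
  -- The group inverse of a unit satisfies the equations of the inverse in an inverse monoid, so the
  -- two coincide, and any representative of a unit is essential.
  have hinv : (mk a)⁻¹ = (u⁻¹ : (CuntzInverseMonoid n)ˣ) := by
    rw [ha]
    exact (eq_inv _ _ (by simp) (by simp)).symm
  have hess : IsEssential a := (isEssential_iff_mk hn).2 (by rw [hinv, ha]; simp)
  exact ⟨⟨a, hess⟩, Units.ext ha⟩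

theorem natLE_essential_iff {a b : essential (DMonoid n)} :
    NatLE a b ↔ NatLE (a : DMonoid n) b :=
  Subtype.ext_iff

/-- An essential element is defined at all long words, so any element above it has the same germ.
Conversely, if `a` and `b` have the same germ, then `inter a b` shares it; being essential depends
only on the class, so the intersection is a common lower bound inside the essential part. -/
theorem sigma_eq_ker (hn : 2 ≤ n) :
    sigma (essential (DMonoid n)) = Con.ker (essentialToUnits hn) := by
  ext a b
  have hker : Con.ker (essentialToUnits hn) a b ↔ mk a.1 = mk b.1 :=
    (Con.ker_rel _).trans Units.ext_iff
  rw [hker]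
  have hle : ∀ c d : essential (DMonoid n), NatLE c d → mk c.1 = mk d.1 := by
    intro c d h
    have h' := natLE_iff.1 (natLE_essential_iff.1 h)
    have hc := (isEssentialIdem_dom_iff hn).1 c.2.1
    refine (mk_eq_mk hn).2 ⟨.of_forall fun w v hv => h' w v hv, ?_⟩
    filter_upwards [hc] with w hw v hv
    obtain ⟨v', hv'⟩ := hw
    rwa [Option.mem_unique hv (h' w v' hv')]
  constructor
  · rintro ⟨c, hca, hcb⟩
    exact (hle c a hca).symm.trans (hle c b hcb)
  · intro h
    have hc : mk (inter a.1 b.1) = mk a.1 := by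
      refine (mk_eq_mk hn).2 ⟨.of_forall fun w v hv => (mem_inter.1 hv).1, ?_⟩
      filter_upwards [((mk_eq_mk hn).1 h).1] with w hw v hv
      exact mem_inter.2 ⟨hv, hw v hv⟩
    have hess : IsEssential (inter a.1 b.1) := by
      rw [isEssential_iff_mk hn, hc, ← isEssential_iff_mk hn]
      exact a.2
    exact ⟨⟨_, hess⟩, natLE_essential_iff.2 (natLE_iff.2 fun w v hv => (mem_inter.1 hv).1),
      natLE_essential_iff.2 (natLE_iff.2 fun w v hv => (mem_inter.1 hv).2)⟩

end CuntzInverseMonoid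

theorem theorem4 (n : ℕ) (hn : 2 ≤ n) :
    InverseMonoid.IsBooleanMeet (CuntzInverseMonoid n) ∧
      Nonempty ((CuntzInverseMonoid n)ˣ ≃* ThompsonGroup n) :=
  ⟨CuntzInverseMonoid.isBooleanMeet hn,
    ⟨((Con.congr (MulEquiv.refl _) (CuntzInverseMonoid.sigma_eq_ker hn)).trans
      (Con.quotientKerEquivOfSurjective _
        (CuntzInverseMonoid.essentialToUnits_surjective hn))).symm⟩⟩
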